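/- Let $\mathbb R\langle x\rangle$ be the algebra of real polynomials in $g$ noncommuting variables $x_1,\dots,x_g$, with the involution $p\mapsto p^T$ that fixes each $x_j$ and reverses words; the degree of a polynomial is the maximal length of a word occurring in it. For $p\in\mathbb R\langle x\rangle$ let $$p''(x)[h]=\frac{d^2}{dt^2}\,p(x+th)\Big|_{t=0}\in\mathbb R\langle x,h\rangle$$ be its Hessian, a polynomial in the $2g$ noncommuting symmetric variables $x_1,\dots,x_g,h_1,\dots,h_g$. For $p$ symmetric ($p=p^T$), let $\sigma_-^{\min}(p'')$ be the smallest number $\sigma_-$ of negative squares in a representation $$p''(x)[h]=\sum_{j=1}^{\sigma_+} f_j^+(x)[h]^T f_j^+(x)[h]-\sum_{\ell=1}^{\sigma_-} f_\ell^-(x)[h]^T f_\ell^-(x)[h]$$ in which all $f_j^+,f_\ell^-\in\mathbb R\langle x,h\rangle$ are homogeneous of degree one in $h$. **Theorem 1.7.** Let $p\in\mathbb R\langle x\rangle$ be a symmetric polynomial of degree $d$, put $\nu=\sum_{i=0}^{d-2}g^i$ (an empty sum, $0$, if $d<2$), and let $k$ be a positive integer. Suppose that $$n>g\,\frac{\nu(\nu-1)}2,$$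 that $X=(X_1,\dots,X_g)$ is a $g$-tuple of real symmetric $n\times n$ matrices, that $v\in\mathbb R^n$, and that there is no nonzero polynomial $q\in\mathbb R\langle x\rangle$ (symmetric or not) of degree at most $d-2$ with $q(X)v=0$. Let $\mathcal H$ be a linear subspace of $(\mathbb R^{n\times n}_{sym})^g$, the space of $g$-tuples of real symmetric $n\times n$ matrices, of codimension at most $kn$ in that space, and suppose that the Hessian of $p$ is positive relative to $\mathcal H$ at $(X,v)$, that is, $$\langle p''(X)[H]v,v\rangle\ge 0\qquad\text{for every } H\in\mathcal H.$$ Then $\sigma_-^{\min}(p'')<k+1$. -/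

import Mathlib

/-- Noncommutative polynomials with real coefficients in the letters `σ`.  The `star` of
`FreeAlgebra ℝ σ` fixes the letters and reverses words: it is the involution `p ↦ pᵀ`. -/
abbrev NCPoly (σ : Type) : Type := FreeAlgebra ℝ σ

/-- Polynomials in `2g` letters: `Sum.inl i` is the letter `x_i`, `Sum.inr i` the letter `h_i`. -/
abbrev NCPolyXH (g : ℕ) : Type := NCPoly (Fin g ⊕ Fin g)

/-- The coefficients `c_m` in the expansion `p = ∑ c_m m` over words. -/
noncomputable def ncCoeff {σ : Type} (p : NCPoly σ) : FreeMonoid σ →₀ ℝ :=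
  (FreeAlgebra.equivMonoidAlgebraFreeMonoid p).coeff

/-- The degree: the maximal length of a word that occurs in `p` (and `0` if `p = 0`). -/
noncomputable def ncDegree {σ : Type} (p : NCPoly σ) : ℕ :=
  (ncCoeff p).support.sup FreeMonoid.length

/-- A polynomial in `x, h` is linear in `h` (homogeneous of degree one in `h`) if exactly one
letter of every word occurring in it is an `h`-letter. -/
def IsLinearInH {g : ℕ} (f : NCPolyXH g) : Prop :=
  ∀ w ∈ (ncCoeff f).support, w.toList.countP Sum.isRight = 1

/-- `p(x + t h)`, a polynomial in the central variable `t` over `ℝ⟨x, h⟩`. -/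
noncomputable def alongLine {g : ℕ} (p : NCPoly (Fin g)) : Polynomial (NCPolyXH g) :=
  FreeAlgebra.lift ℝ
    (fun i => Polynomial.C (FreeAlgebra.ι ℝ (Sum.inl i) : NCPolyXH g)
      + Polynomial.X * Polynomial.C (FreeAlgebra.ι ℝ (Sum.inr i) : NCPolyXH g)) p

/-- The Hessian `p''(x)[h]`, the second `t`-derivative of `p(x + t h)` at `t = 0`. -/
noncomputable def ncHessian {g : ℕ} (p : NCPoly (Fin g)) : NCPolyXH g :=
  (Polynomial.derivative (Polynomial.derivative (alongLine p))).eval 0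

/-- `f = ∑ (f⁺_j)ᵀ f⁺_j - ∑ (f⁻_l)ᵀ f⁻_l` with `s` negative squares (and any finite number of
positive ones), all the `f⁺_j, f⁻_l` being linear in `h`. -/
def HasSDS {g : ℕ} (f : NCPolyXH g) (s : ℕ) : Prop :=
  ∃ (r : ℕ) (fp : Fin r → NCPolyXH g) (fm : Fin s → NCPolyXH g),
    (∀ j, IsLinearInH (fp j)) ∧ (∀ l, IsLinearInH (fm l)) ∧
      f = ∑ j, star (fp j) * fp j - ∑ l, star (fm l) * fm l

/-- The negative signature: the least number of negative squares in such a representation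
(`⊤` if there is none). -/
noncomputable def sigmaMinNeg {g : ℕ} (f : NCPolyXH g) : ℕ∞ :=
  ⨅ s ∈ {s : ℕ | HasSDS f s}, (s : ℕ∞)

/-- Real symmetric `n × n` matrices. -/
def SymMat (n : ℕ) : Submodule ℝ (Matrix (Fin n) (Fin n) ℝ) where
  carrier := {A | A.IsSymm}
  add_mem' hA hB := Matrix.IsSymm.add hA hB
  zero_mem' := Matrix.isSymm_zero
  smul_mem' c _ hA := Matrix.IsSymm.smul hA c

/-- The space of `g`-tuples of real symmetric `n × n` matrices. -/
abbrev SymTuple (g n : ℕ) : Type := Fin g → SymMat n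

/-- The value `q(X)`. -/
noncomputable def ncEval {g n : ℕ} (X : SymTuple g n) (q : NCPoly (Fin g)) :
    Matrix (Fin n) (Fin n) ℝ :=
  FreeAlgebra.lift ℝ (fun i => (X i : Matrix (Fin n) (Fin n) ℝ)) q

/-- The value `f(X)[H]`. -/
noncomputable def ncEvalXH {g n : ℕ} (X H : SymTuple g n) (f : NCPolyXH g) :
    Matrix (Fin n) (Fin n) ℝ :=
  FreeAlgebra.lift ℝ
    (Sum.elim (fun i => (X i : Matrix (Fin n) (Fin n) ℝ))
      (fun i => (H i : Matrix (Fin n) (Fin n) ℝ))) f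

/-- The Hessian of `p` is positive relative to `𝓗` at `(X, v)`. -/
def HessianPosRel {g n : ℕ} (p : NCPoly (Fin g)) (𝓗 : Submodule ℝ (SymTuple g n))
    (X : SymTuple g n) (v : Fin n → ℝ) : Prop :=
  ∀ H ∈ 𝓗, 0 ≤ (ncEvalXH X H (ncHessian p)).mulVec v ⬝ᵥ v

/-- `ν = 1 + g + ⋯ + g^(d-2)`, the number of words of length at most `d - 2` in `g` letters
(the empty sum `0` for `d < 2`). -/
def wordCount (g d : ℕ) : ℕ := ∑ i ∈ Finset.range (d - 1), g ^ i

/-! The Hessian is a quadratic form in the derivatives of words, and after a suitable reweighting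
its middle matrix has scalar entries. Let `β` be the coefficients of (1 - t)^(-1/2), and let T_w be
the derivative of the word w in which the term replacing the letter in position s has weight `β s`.
Since β convolved with itself is constantly 1, p'' = 2 ∑ Z_{u,y} T_uᵀ T_y, where Z_{u,y} is the
coefficient of uᵀy in p and u, y are nonempty words of length at most d - 1 (`coeff_two_alongLine`,
`ncHessian_eq_sum`). Diagonalizing the symmetric matrix Z orthogonally gives p'' = ∑ μ_i F_iᵀ F_i,
so σ₋^min is at most the number m₋ of negative μ_i.

The bound on m₋ is a dimension count. Let H ∈ 𝓗 satisfy F_i(X)[H]v = 0 whenever μ_i ≥ 0. The form is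
then a sum of nonpositive terms and is also nonnegative, so every F_i(X)[H]v vanishes. Inverting U,
and then the triangular passage from T_w to its leading terms, gives H_j c(X)v = 0 for all letters j
and words c of length at most d - 2. Hence the rank of H ↦ (H_j c(X)v) is at most (gν - m₋)n + kn.
The vectors c(X)v are independent, so symmetry of the H_j costs only ν(ν-1)/2 conditions per letter,
and the rank is at least gνn - gν(ν-1)/2 (`le_finrank_range_borderMap`). Therefore m₋n ≤ kn +
gν(ν-1)/2 < (k+1)n. -/

/-! ### Coefficients, the involution and linearity in h. -/

/-- The monomial of a word. -/
noncomputable def ncMon {σ : Type} (w : List σ) : NCPoly σ := (w.map (FreeAlgebra.ι ℝ)).prod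

theorem ncMon_nil {σ : Type} : ncMon ([] : List σ) = 1 := rfl

theorem ncMon_cons {σ : Type} (i : σ) (w : List σ) :
    ncMon (i :: w) = FreeAlgebra.ι ℝ i * ncMon w := by simp [ncMon]

theorem equivMonoidAlgebra_ncMon {σ : Type} (w : List σ) :
    FreeAlgebra.equivMonoidAlgebraFreeMonoid (ncMon w)
      = MonoidAlgebra.single (FreeMonoid.ofList w) (1 : ℝ) := by
  induction w with
  | nil => rw [ncMon_nil, map_one]; rfl
  | cons i w ih =>
    rw [ncMon_cons, map_mul, ih]
    simp [FreeAlgebra.equivMonoidAlgebraFreeMonoid, MonoidAlgebra.single_mul_single]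

theorem ncCoeff_ncMon {σ : Type} (w : List σ) :
    ncCoeff (ncMon w) = Finsupp.single (FreeMonoid.ofList w) 1 := by
  rw [ncCoeff, equivMonoidAlgebra_ncMon]; rfl

theorem ncCoeff_zero {σ : Type} : ncCoeff (0 : NCPoly σ) = 0 := by simp [ncCoeff]

theorem ncCoeff_add {σ : Type} (p q : NCPoly σ) : ncCoeff (p + q) = ncCoeff p + ncCoeff q := by
  simp [ncCoeff]

theorem ncCoeff_smul {σ : Type} (c : ℝ) (p : NCPoly σ) : ncCoeff (c • p) = c • ncCoeff p := by
  simp [ncCoeff]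

theorem ncCoeff_sum {σ ι : Type} (s : Finset ι) (f : ι → NCPoly σ) :
    ncCoeff (∑ i ∈ s, f i) = ∑ i ∈ s, ncCoeff (f i) := by
  classical
  induction s using Finset.induction_on with
  | empty => simp [ncCoeff_zero]
  | insert a s ha ih => rw [Finset.sum_insert ha, Finset.sum_insert ha, ncCoeff_add, ih]

theorem ncCoeff_injective {σ : Type} : Function.Injective (ncCoeff (σ := σ)) := fun _ _ h =>
  FreeAlgebra.equivMonoidAlgebraFreeMonoid.injective (MonoidAlgebra.coeff_injective h)

theorem eq_sum_ncCoeff {σ : Type} (p : NCPoly σ) :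
    p = ∑ w ∈ (ncCoeff p).support, ncCoeff p w • ncMon w.toList := by
  apply ncCoeff_injective
  rw [ncCoeff_sum]
  simp only [ncCoeff_smul, ncCoeff_ncMon, FreeMonoid.ofList_toList, Finsupp.smul_single,
    smul_eq_mul, mul_one]
  exact (Finsupp.sum_single _).symm

theorem ncMon_append {σ : Type} (u w : List σ) : ncMon (u ++ w) = ncMon u * ncMon w := by
  simp [ncMon]

theorem star_smul_nc {σ : Type} (c : ℝ) (p : NCPoly σ) : star (c • p) = c • star p := by
  rw [Algebra.smul_def, star_mul, FreeAlgebra.star_algebraMap, Algebra.smul_def]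
  exact (Algebra.commutes c (star p)).symm

theorem star_ncMon {σ : Type} (w : List σ) : star (ncMon w) = ncMon w.reverse := by
  induction w with
  | nil => simp [ncMon_nil]
  | cons i w ih =>
    rw [ncMon_cons, star_mul, ih, FreeAlgebra.star_ι, List.reverse_cons, ncMon_append]
    simp [ncMon]

theorem ncCoeff_star {σ : Type} (p : NCPoly σ) (w : List σ) :
    ncCoeff (star p) (FreeMonoid.ofList w) = ncCoeff p (FreeMonoid.ofList w.reverse) := by
  classical
  conv_lhs => rw [eq_sum_ncCoeff p]
  conv_rhs => rw [eq_sum_ncCoeff p]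
  rw [star_sum, ncCoeff_sum, ncCoeff_sum, Finsupp.finsetSum_apply, Finsupp.finsetSum_apply]
  refine Finset.sum_congr rfl fun u _ => ?_
  rw [star_smul_nc, star_ncMon, ncCoeff_smul, ncCoeff_smul, ncCoeff_ncMon, ncCoeff_ncMon]
  simp only [Finsupp.smul_apply, Finsupp.single_apply]
  congr 1
  refine if_congr ?_ rfl rfl
  rw [EmbeddingLike.apply_eq_iff_eq, EmbeddingLike.apply_eq_iff_eq]
  constructor
  · rintro rfl; simp
  · intro h; rw [h]; simp

theorem isLinearInH_zero {g : ℕ} : IsLinearInH (0 : NCPolyXH g) := by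
  intro w hw; simp [ncCoeff_zero] at hw

theorem IsLinearInH.add {g : ℕ} {f f' : NCPolyXH g} (h : IsLinearInH f) (h' : IsLinearInH f') :
    IsLinearInH (f + f') := by
  classical
  intro w hw
  rw [ncCoeff_add] at hw
  rcases Finset.mem_union.mp (Finsupp.support_add hw) with hw | hw
  exacts [h w hw, h' w hw]

theorem IsLinearInH.smul {g : ℕ} {f : NCPolyXH g} (h : IsLinearInH f) (c : ℝ) :
    IsLinearInH (c • f) := by
  intro w hw
  rw [ncCoeff_smul] at hw
  exact h w (Finsupp.support_smul hw)

theorem IsLinearInH.sum {g : ℕ} {ι : Type} (s : Finset ι) {f : ι → NCPolyXH g}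
    (h : ∀ i ∈ s, IsLinearInH (f i)) : IsLinearInH (∑ i ∈ s, f i) := by
  classical
  induction s using Finset.induction_on with
  | empty => exact isLinearInH_zero
  | insert a s ha ih =>
    rw [Finset.sum_insert ha]
    exact (h a (by simp)).add (ih fun i hi => h i (by simp [hi]))

theorem isLinearInH_ncMon {g : ℕ} {w : List (Fin g ⊕ Fin g)} (hw : w.countP Sum.isRight = 1) :
    IsLinearInH (ncMon w) := by
  intro u hu
  rw [ncCoeff_ncMon] at hu
  have := Finsupp.support_single_subset hu
  rw [Finset.mem_singleton] at this
  subst this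
  exact hw

theorem IsLinearInH.x_mul {g : ℕ} {f : NCPolyXH g} (h : IsLinearInH f) (i : Fin g) :
    IsLinearInH (FreeAlgebra.ι ℝ (Sum.inl i) * f) := by
  rw [eq_sum_ncCoeff f, Finset.mul_sum]
  refine IsLinearInH.sum _ fun w hw => ?_
  rw [mul_smul_comm, ← ncMon_cons]
  refine IsLinearInH.smul (isLinearInH_ncMon ?_) _
  simpa using h w hw

/-! ### Weighted derivatives of words. -/

/-- These are the coefficients of (1 - t)^(-1/2), whose square is the geometric series 1/(1 - t). -/
theorem exists_conv_sqrt : ∃ β : ℕ → ℝ, β 0 ≠ 0 ∧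
    ∀ N, ∑ a ∈ Finset.HasAntidiagonal.antidiagonal N, β a.1 * β a.2 = 1 := by
  let b : PowerSeries ℝ := PowerSeries.rescale (-1 : ℝ) (PowerSeries.binomialSeries ℝ (-1 / 2 : ℝ))
  have hb : ∀ N, PowerSeries.coeff N (b * b) = 1 := by
    intro N
    simp only [b]
    rw [← map_mul, ← PowerSeries.binomialSeries_add, PowerSeries.coeff_rescale,
      PowerSeries.binomialSeries_coeff]
    rw [show (-1 / 2 + -1 / 2 : ℝ) = -1 by norm_num, Ring.choose_neg]
    rw [show (1 + (N : ℝ) - 1) = (N : ℝ) by ring, Ring.choose_natCast, Nat.choose_self,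
      Units.smul_def, zsmul_eq_mul, Int.cast_negOnePow_natCast]
    simp [← mul_pow]
  refine ⟨fun n => PowerSeries.coeff n b, ?_, fun N => ?_⟩
  · intro h
    have := hb 0
    rw [PowerSeries.coeff_mul] at this
    simp only [Finset.HasAntidiagonal.antidiagonal_zero, Finset.sum_singleton] at this
    simp only at h
    rw [h] at this
    simp at this
  · rw [← PowerSeries.coeff_mul, hb]

/-- A word in the letters `x`, as a polynomial in `x, h`. -/
noncomputable def xMon {g : ℕ} (w : List (Fin g)) : NCPolyXH g := ncMon (w.map Sum.inl)

theorem xMon_nil {g : ℕ} : xMon ([] : List (Fin g)) = 1 := rfl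

theorem xMon_cons {g : ℕ} (i : Fin g) (w : List (Fin g)) :
    xMon (i :: w) = FreeAlgebra.ι ℝ (Sum.inl i) * xMon w := by
  rw [xMon, List.map_cons, ncMon_cons, xMon]

theorem star_xMon {g : ℕ} (w : List (Fin g)) : star (xMon w) = xMon w.reverse := by
  rw [xMon, star_ncMon, xMon, List.map_reverse]

theorem xMon_append {g : ℕ} (u w : List (Fin g)) : xMon (u ++ w) = xMon u * xMon w := by
  rw [xMon, List.map_append, ncMon_append, xMon, xMon]

/-- The derivative of the word `w` in the direction `h`, in which the term that replaces the
letter in position `s` carries the weight `γ s`. -/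
noncomputable def weightedDeriv {g : ℕ} : (ℕ → ℝ) → List (Fin g) → NCPolyXH g
  | _, [] => 0
  | γ, i :: w => γ 0 • (FreeAlgebra.ι ℝ (Sum.inr i) * xMon w)
      + FreeAlgebra.ι ℝ (Sum.inl i) * weightedDeriv (fun s => γ (s + 1)) w

theorem weightedDeriv_nil {g : ℕ} (γ : ℕ → ℝ) : weightedDeriv γ ([] : List (Fin g)) = 0 := rfl

theorem weightedDeriv_cons {g : ℕ} (γ : ℕ → ℝ) (i : Fin g) (w : List (Fin g)) :
    weightedDeriv γ (i :: w) = γ 0 • (FreeAlgebra.ι ℝ (Sum.inr i) * xMon w)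
      + FreeAlgebra.ι ℝ (Sum.inl i) * weightedDeriv (fun s => γ (s + 1)) w := rfl

theorem isLinearInH_weightedDeriv {g : ℕ} (γ : ℕ → ℝ) (w : List (Fin g)) :
    IsLinearInH (weightedDeriv γ w) := by
  induction w generalizing γ with
  | nil => exact isLinearInH_zero
  | cons i w ih =>
    rw [weightedDeriv_cons]
    refine IsLinearInH.add (IsLinearInH.smul ?_ _) ((ih _).x_mul i)
    rw [xMon, ← ncMon_cons]
    refine isLinearInH_ncMon ?_
    rw [List.countP_cons, List.countP_map, List.countP_eq_zero.mpr] <;> simp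

theorem weightedDeriv_add {g : ℕ} (γ δ : ℕ → ℝ) (w : List (Fin g)) :
    weightedDeriv (fun s => γ s + δ s) w = weightedDeriv γ w + weightedDeriv δ w := by
  induction w generalizing γ δ with
  | nil => simp [weightedDeriv_nil]
  | cons i w ih =>
    simp only [weightedDeriv_cons]
    rw [ih (fun s => γ (s + 1)) (fun s => δ (s + 1)), add_smul, mul_add]
    abel

theorem weightedDeriv_smul {g : ℕ} (c : ℝ) (γ : ℕ → ℝ) (w : List (Fin g)) :
    weightedDeriv (fun s => c * γ s) w = c • weightedDeriv γ w := by
  induction w generalizing γ with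
  | nil => simp [weightedDeriv_nil]
  | cons i w ih =>
    simp only [weightedDeriv_cons]
    rw [ih (fun s => γ (s + 1)), mul_smul, smul_add, mul_smul_comm]

theorem weightedDeriv_concat {g : ℕ} (γ : ℕ → ℝ) (w : List (Fin g)) (i : Fin g) :
    weightedDeriv γ (w ++ [i]) = weightedDeriv γ w * FreeAlgebra.ι ℝ (Sum.inl i)
      + γ w.length • (xMon w * FreeAlgebra.ι ℝ (Sum.inr i)) := by
  induction w generalizing γ with
  | nil => simp [weightedDeriv_cons, weightedDeriv_nil, xMon_nil]
  | cons j w ih =>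
    rw [List.cons_append, weightedDeriv_cons, ih, weightedDeriv_cons, xMon_append, xMon_cons,
      xMon_cons, xMon_nil, List.length_cons]
    simp only [mul_add, add_mul, mul_one, smul_mul_assoc, mul_smul_comm, mul_assoc, add_assoc]

/-- After reversal and transposition the weights count from the right end, so a new first letter
gets the largest index and the other weights do not shift. -/
theorem star_weightedDeriv_reverse_cons {g : ℕ} (γ : ℕ → ℝ) (i : Fin g) (u : List (Fin g)) :
    star (weightedDeriv γ (i :: u).reverse) =
      γ u.length • (FreeAlgebra.ι ℝ (Sum.inr i) * xMon u)
        + FreeAlgebra.ι ℝ (Sum.inl i) * star (weightedDeriv γ u.reverse) := by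
  rw [List.reverse_cons, weightedDeriv_concat, star_add, star_smul_nc, star_mul, star_mul,
    star_xMon, FreeAlgebra.star_ι, FreeAlgebra.star_ι, List.reverse_reverse, List.length_reverse,
    add_comm]

/-- The term replacing position s arises from each cut l ≤ s, with weight α l · γ (s - l); summing
over l gives the convolution. -/
theorem sum_xMon_mul_weightedDeriv {g : ℕ} (α γ : ℕ → ℝ) (w : List (Fin g)) :
    ∑ l ∈ Finset.range (w.length + 1), α l • (xMon (w.take l) * weightedDeriv γ (w.drop l))
      = weightedDeriv
        (fun N => ∑ a ∈ Finset.HasAntidiagonal.antidiagonal N, α a.1 * γ a.2) w := by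
  induction w generalizing α with
  | nil => simp [weightedDeriv_nil]
  | cons i w ih =>
    rw [List.length_cons, Finset.sum_range_succ']
    simp only [List.take_succ_cons, List.drop_succ_cons, List.take_zero, List.drop_zero, xMon_nil,
      one_mul, xMon_cons, mul_assoc]
    simp only [← mul_smul_comm]
    rw [← Finset.mul_sum]
    simp only [mul_smul_comm]
    rw [ih (fun l => α (l + 1))]
    simp only [weightedDeriv_cons, Finset.Nat.sum_antidiagonal_succ]
    rw [weightedDeriv_add (fun s => α 0 * γ (s + 1)), weightedDeriv_smul]
    simp only [Finset.HasAntidiagonal.antidiagonal_zero, Finset.sum_singleton, smul_add, mul_add, mul_smul,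
      mul_smul_comm]
    abel

/-! ### Expansion of p(x + th) up to order two. -/

theorem alongLine_ncMon_cons {g : ℕ} (i : Fin g) (w : List (Fin g)) :
    alongLine (ncMon (i :: w)) =
      (Polynomial.C (FreeAlgebra.ι ℝ (Sum.inl i) : NCPolyXH g)
        + Polynomial.X * Polynomial.C (FreeAlgebra.ι ℝ (Sum.inr i) : NCPolyXH g))
      * alongLine (ncMon w) := by
  rw [alongLine, ncMon_cons, map_mul, FreeAlgebra.lift_ι_apply, ← alongLine]

theorem alongLine_ncMon_nil {g : ℕ} : alongLine (ncMon ([] : List (Fin g))) = 1 := by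
  rw [alongLine, ncMon_nil, map_one]

theorem coeff_zero_alongLine {g : ℕ} (w : List (Fin g)) :
    (alongLine (ncMon w)).coeff 0 = xMon w := by
  induction w with
  | nil => simp [alongLine_ncMon_nil, xMon_nil]
  | cons i w ih =>
    rw [alongLine_ncMon_cons, add_mul, mul_assoc, Polynomial.coeff_add, Polynomial.coeff_C_mul, ih,
      Polynomial.mul_coeff_zero, Polynomial.coeff_X_zero, zero_mul, add_zero, xMon_cons]

theorem coeff_one_alongLine {g : ℕ} (w : List (Fin g)) :
    (alongLine (ncMon w)).coeff 1 = weightedDeriv (fun _ => 1) w := by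
  induction w with
  | nil => simp [alongLine_ncMon_nil, weightedDeriv_nil, Polynomial.coeff_one]
  | cons i w ih =>
    rw [alongLine_ncMon_cons, add_mul, mul_assoc, Polynomial.coeff_add, Polynomial.coeff_C_mul, ih,
      Polynomial.coeff_X_mul, Polynomial.coeff_C_mul, coeff_zero_alongLine, weightedDeriv_cons,
      one_smul, add_comm]

/-- Replacing the letters in positions s < s' yields one term on the left. On the right it arises
from every cut between them, with weights indexed by the distances to the cut; these indices add up
to s' - s - 1, so the total weight is 1. -/
theorem coeff_two_alongLine {g : ℕ} {β : ℕ → ℝ}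
    (hβ : ∀ N, ∑ a ∈ Finset.HasAntidiagonal.antidiagonal N, β a.1 * β a.2 = 1)
    (w : List (Fin g)) :
    (alongLine (ncMon w)).coeff 2 = ∑ l ∈ Finset.range (w.length + 1),
      star (weightedDeriv β (w.take l).reverse) * weightedDeriv β (w.drop l) := by
  induction w with
  | nil => simp [alongLine_ncMon_nil, weightedDeriv_nil, Polynomial.coeff_one]
  | cons i w ih =>
    rw [alongLine_ncMon_cons, add_mul, mul_assoc, Polynomial.coeff_add, Polynomial.coeff_C_mul, ih,
      Polynomial.coeff_X_mul, Polynomial.coeff_C_mul, coeff_one_alongLine, List.length_cons,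
      Finset.sum_range_succ' _ (w.length + 1)]
    simp only [List.take_succ_cons, List.drop_succ_cons, List.take_zero, List.drop_zero,
      List.reverse_nil, weightedDeriv_nil, star_zero, zero_mul, add_zero,
      star_weightedDeriv_reverse_cons, add_mul, Finset.sum_add_distrib, Finset.mul_sum, mul_assoc]
    rw [add_comm]
    congr 1
    -- Pairs containing the first letter leave the unweighted derivative of the tail, whose constant
    -- weight 1 is β convolved with itself.
    have h := sum_xMon_mul_weightedDeriv β β w
    simp only [hβ] at h
    rw [← h, Finset.mul_sum]
    refine Finset.sum_congr rfl fun l hl => ?_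
    rw [List.length_take, min_eq_left (by simpa [Nat.lt_succ_iff] using hl), smul_mul_assoc,
      mul_smul_comm, mul_assoc]

theorem ncHessian_eq {g : ℕ} (p : NCPoly (Fin g)) :
    ncHessian p = (2 : ℝ) • (alongLine p).coeff 2 := by
  rw [ncHessian, ← Polynomial.coeff_zero_eq_eval_zero, Polynomial.coeff_derivative,
    Polynomial.coeff_derivative]
  norm_num [two_smul, mul_two]

theorem alongLine_sum {g : ℕ} {ι : Type} (s : Finset ι) (c : ι → ℝ) (f : ι → NCPoly (Fin g)) :
    alongLine (∑ i ∈ s, c i • f i) = ∑ i ∈ s, c i • alongLine (f i) := by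
  simp only [alongLine, map_sum, map_smul]

/-! ### The scalar middle matrix. -/

/-- The words of length at most `d - 2`. -/
abbrev ShortWord (g d : ℕ) : Type := {w : List (Fin g) // w.length + 2 ≤ d}

noncomputable instance (g d : ℕ) : Fintype (ShortWord g d) :=
  ((List.finite_length_le (Fin g) d).subset fun w (hw : w.length + 2 ≤ d) =>
    show w.length ≤ d by omega).fintype

/-- The nonempty word `x_j c` named by the index `(j, c)`. -/
def idxWord {g d : ℕ} (u : Fin g × ShortWord g d) : List (Fin g) := u.1 :: u.2.1

theorem idxWord_injective {g d : ℕ} : Function.Injective (idxWord (g := g) (d := d)) := by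
  rintro ⟨i, c, hc⟩ ⟨j, e, he⟩ h
  simp only [idxWord, List.cons.injEq] at h
  obtain ⟨rfl, rfl⟩ := h
  rfl

theorem exists_idxWord {g d : ℕ} {w : List (Fin g)} (h0 : w ≠ []) (h : w.length + 1 ≤ d) :
    ∃ u : Fin g × ShortWord g d, idxWord u = w := by
  cases w with
  | nil => exact absurd rfl h0
  | cons i w => exact ⟨(i, ⟨w, by rw [List.length_cons] at h; omega⟩), rfl⟩

-- The pairs on the left are the cuts of w into two nonempty pieces, each of length at most d - 1.
-- The two extreme cuts contribute nothing because `F` and `G` vanish on the empty word.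
open Classical in
theorem sum_idx_eq_sum_range {g d : ℕ} {A : Type*} [NonUnitalNonAssocSemiring A]
    (F G : List (Fin g) → A) (hF : F [] = 0) (hG : G [] = 0)
    (w : List (Fin g)) (hw : w.length ≤ d) :
    ∑ a ∈ (Finset.univ : Finset ((Fin g × ShortWord g d) × (Fin g × ShortWord g d))) with
        (idxWord a.1).reverse ++ idxWord a.2 = w, F (idxWord a.1) * G (idxWord a.2)
      = ∑ l ∈ Finset.range (w.length + 1), F (w.take l).reverse * G (w.drop l) := by
  refine Finset.sum_of_injOn (fun a => (idxWord a.1).length) ?_ ?_ ?_ ?_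
  · rintro ⟨a, b⟩ ha ⟨a', b'⟩ ha' h
    simp only [Finset.coe_filter, Finset.mem_univ, true_and, Set.mem_ofPred_eq] at ha ha' h
    have := List.append_inj (ha.trans ha'.symm) (by simpa using h)
    exact Prod.ext (idxWord_injective (List.reverse_injective this.1)) (idxWord_injective this.2)
  · rintro ⟨a, b⟩ ha
    simp only [Finset.coe_filter, Finset.mem_univ, true_and, Set.mem_ofPred_eq] at ha
    simp only [Finset.coe_range, Set.mem_Iio, ← ha, List.length_append, List.length_reverse]
    omega
  · intro l hl hn
    rw [Finset.mem_range] at hl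
    by_cases h0 : l = 0
    · subst h0; simp [hF]
    by_cases h1 : l = w.length
    · subst h1; simp [hG]
    exfalso
    apply hn
    obtain ⟨a, ha⟩ := exists_idxWord (d := d) (w := (w.take l).reverse)
      (by rw [Ne, List.reverse_eq_nil_iff, ← List.length_eq_zero_iff, List.length_take]; omega)
      (by rw [List.length_reverse, List.length_take]; omega)
    obtain ⟨b, hb⟩ := exists_idxWord (d := d) (w := w.drop l)
      (by rw [Ne, ← List.length_eq_zero_iff, List.length_drop]; omega)
      (by rw [List.length_drop]; omega)
    refine ⟨(a, b), ?_, ?_⟩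
    · simp [ha, hb]
    · simp only [ha, List.length_reverse, List.length_take]; omega
  · rintro ⟨a, b⟩ ha
    simp only [Finset.mem_filter, Finset.mem_univ, true_and] at ha
    subst ha
    simp only []
    rw [List.take_left' (by simp), List.drop_left' (by simp), List.reverse_reverse]

/-- The scalar middle matrix of the Hessian of `p`. -/
noncomputable def middleMatrix {g : ℕ} (d : ℕ) (p : NCPoly (Fin g)) :
    Matrix (Fin g × ShortWord g d) (Fin g × ShortWord g d) ℝ :=
  fun u y => ncCoeff p (FreeMonoid.ofList ((idxWord u).reverse ++ idxWord y))

theorem middleMatrix_transpose {g d : ℕ} {p : NCPoly (Fin g)} (hp : star p = p) :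
    (middleMatrix d p).transpose = middleMatrix d p := by
  ext u y
  rw [Matrix.transpose_apply, middleMatrix, middleMatrix]
  conv_lhs => rw [← hp]
  rw [ncCoeff_star, List.reverse_append, List.reverse_reverse]

theorem ncHessian_eq_sum {g d : ℕ} {p : NCPoly (Fin g)} (hd : ncDegree p ≤ d) {β : ℕ → ℝ}
    (hβ : ∀ N, ∑ a ∈ Finset.HasAntidiagonal.antidiagonal N, β a.1 * β a.2 = 1) :
    ncHessian p = (2 : ℝ) • ∑ u : Fin g × ShortWord g d, ∑ y : Fin g × ShortWord g d,
      middleMatrix d p u y •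
        (star (weightedDeriv β (idxWord u)) * weightedDeriv β (idxWord y)) := by
  classical
  rw [ncHessian_eq]
  congr 1
  conv_lhs => rw [eq_sum_ncCoeff p, alongLine_sum, Polynomial.finsetSum_coeff]
  simp only [Polynomial.coeff_smul, coeff_two_alongLine hβ]
  rw [← Fintype.sum_prod_type']
  have key : ∀ w ∈ (ncCoeff p).support,
      ncCoeff p w • ∑ l ∈ Finset.range (w.toList.length + 1),
        star (weightedDeriv β (w.toList.take l).reverse) * weightedDeriv β (w.toList.drop l)
      = ∑ a : (Fin g × ShortWord g d) × (Fin g × ShortWord g d),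
          if FreeMonoid.ofList ((idxWord a.1).reverse ++ idxWord a.2) = w then
            ncCoeff p w • (star (weightedDeriv β (idxWord a.1)) * weightedDeriv β (idxWord a.2))
          else 0 := by
    intro w hw
    rw [← sum_idx_eq_sum_range (d := d) (fun u => star (weightedDeriv β u)) (weightedDeriv β)
      (by simp [weightedDeriv_nil]) (by simp [weightedDeriv_nil]) w.toList
      ((Finset.le_sup (f := FreeMonoid.length) hw).trans hd), Finset.smul_sum, Finset.sum_filter]
    exact Finset.sum_congr rfl fun a _ => if_congr Iff.rfl rfl rfl
  rw [Finset.sum_congr rfl key, Finset.sum_comm]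
  refine Finset.sum_congr rfl fun a _ => ?_
  rw [Finset.sum_ite_eq]
  split_ifs with h
  · rfl
  · rw [Finsupp.notMem_support_iff] at h
    rw [middleMatrix, h, zero_smul]

/-! ### Diagonalization and sums of squares. -/

open Matrix in
theorem exists_orthogonal_diagonalization {ι : Type} [Fintype ι] [DecidableEq ι]
    {Z : Matrix ι ι ℝ} (hZ : Zᵀ = Z) :
    ∃ (U : Matrix ι ι ℝ) (l : ι → ℝ), U * Uᵀ = 1 ∧ Z = U * diagonal l * Uᵀ := by
  have h : Z.IsHermitian := by rw [Matrix.IsHermitian, conjTranspose_eq_transpose_of_trivial, hZ]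
  refine ⟨h.eigenvectorUnitary, h.eigenvalues, ?_, ?_⟩
  · have := Unitary.coe_mul_star_self h.eigenvectorUnitary
    rwa [Unitary.coe_star, star_eq_conjTranspose, conjTranspose_eq_transpose_of_trivial] at this
  · have := h.spectral_theorem
    rw [Unitary.conjStarAlgAut_apply, star_eq_conjTranspose,
      conjTranspose_eq_transpose_of_trivial] at this
    exact this

/-- Each √|μ_i| is absorbed into its square; vanishing μ_i count as positive squares. -/
theorem hasSDS_of_eq_sum {g : ℕ} {ι : Type} [Fintype ι] (μ : ι → ℝ) {F : ι → NCPolyXH g}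
    (hF : ∀ i, IsLinearInH (F i)) {f : NCPolyXH g}
    (hf : f = ∑ i, μ i • (star (F i) * F i)) :
    HasSDS f (Nat.card {i // μ i < 0}) := by
  classical
  let ep : Fin (Nat.card {i // ¬ μ i < 0}) ≃ {i // ¬ μ i < 0} := (Finite.equivFin _).symm
  let em : Fin (Nat.card {i // μ i < 0}) ≃ {i // μ i < 0} := (Finite.equivFin _).symm
  refine ⟨_, fun j => √(μ (ep j)) • F (ep j), fun j => √(-μ (em j)) • F (em j),
    fun j => (hF _).smul _, fun j => (hF _).smul _, ?_⟩
  have h1 : ∀ j, star (√(μ (ep j)) • F (ep j)) * (√(μ (ep j)) • F (ep j))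
      = μ (ep j) • (star (F (ep j)) * F (ep j)) := fun j => by
    rw [star_smul_nc, smul_mul_smul_comm, Real.mul_self_sqrt (not_lt.mp (ep j).2)]
  have h2 : ∀ j, star (√(-μ (em j)) • F (em j)) * (√(-μ (em j)) • F (em j))
      = -(μ (em j) • (star (F (em j)) * F (em j))) := fun j => by
    rw [star_smul_nc, smul_mul_smul_comm, Real.mul_self_sqrt (neg_nonneg.mpr (em j).2.le), neg_smul]
  simp only [h1, h2, Finset.sum_neg_distrib, sub_neg_eq_add]
  rw [ep.sum_comp (fun i => μ i • (star (F i) * F i)),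
    em.sum_comp (fun i => μ i • (star (F i) * F i)), hf, add_comm]
  exact (Fintype.sum_subtype_add_sum_subtype (fun i => μ i < 0) _).symm

theorem ncHessian_eq_sum_squares {g d : ℕ} {p : NCPoly (Fin g)} (hp : star p = p)
    (hd : ncDegree p ≤ d) :
    ∃ (β : ℕ → ℝ) (U : Matrix (Fin g × ShortWord g d) (Fin g × ShortWord g d) ℝ)
      (μ : Fin g × ShortWord g d → ℝ), β 0 ≠ 0 ∧ U * U.transpose = 1 ∧
      ncHessian p = ∑ i, μ i • (star (∑ u, U u i • weightedDeriv β (idxWord u))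
        * ∑ u, U u i • weightedDeriv β (idxWord u)) := by
  classical
  obtain ⟨β, hβ0, hβ⟩ := exists_conv_sqrt
  obtain ⟨U, l, hU, hZ⟩ := exists_orthogonal_diagonalization (middleMatrix_transpose (d := d) hp)
  -- The factor 2 is that of the second derivative relative to the t² coefficient.
  refine ⟨β, U, fun i => 2 * l i, hβ0, by convert hU, ?_⟩
  have hZ' : ∀ u y, middleMatrix d p u y = ∑ i, l i * U u i * U y i := fun u y => by
    rw [hZ, Matrix.mul_apply]
    refine Finset.sum_congr rfl fun i _ => ?_
    rw [Matrix.mul_diagonal, Matrix.transpose_apply]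
    ring
  rw [ncHessian_eq_sum hd hβ]
  simp only [mul_smul, ← Finset.smul_sum]
  congr 1
  simp only [hZ', Finset.sum_smul]
  have : ∀ i, l i • (star (∑ u, U u i • weightedDeriv β (idxWord u))
      * ∑ u, U u i • weightedDeriv β (idxWord u))
      = ∑ u : Fin g × ShortWord g d, ∑ y : Fin g × ShortWord g d, (l i * U u i * U y i) •
        (star (weightedDeriv β (idxWord u)) * weightedDeriv β (idxWord y)) := fun i => by
    rw [star_sum, Finset.sum_mul_sum, Finset.smul_sum]
    refine Finset.sum_congr rfl fun u _ => ?_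
    rw [Finset.smul_sum]
    refine Finset.sum_congr rfl fun y _ => ?_
    rw [star_smul_nc, smul_mul_smul_comm, smul_smul, mul_assoc]
  simp only [this]
  conv_rhs => rw [Finset.sum_comm]
  exact Finset.sum_congr rfl fun u _ => Finset.sum_comm

/-! ### Evaluation at (X, v). -/

/-- The map `H ↦ H_i y`. -/
noncomputable def dirEval {g n : ℕ} (i : Fin g) (y : Fin n → ℝ) :
    SymTuple g n →ₗ[ℝ] (Fin n → ℝ) where
  toFun H := (H i : Matrix (Fin n) (Fin n) ℝ).mulVec y
  map_add' H K := by simp [Matrix.add_mulVec]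
  map_smul' c H := by simp [Matrix.smul_mulVec]

theorem dirEval_apply {g n : ℕ} (i : Fin g) (y : Fin n → ℝ) (H : SymTuple g n) :
    dirEval i y H = (H i : Matrix (Fin n) (Fin n) ℝ).mulVec y := rfl

/-- The vector `c(X) v` of a word `c`. -/
noncomputable def wordVec {g n : ℕ} (X : SymTuple g n) (v : Fin n → ℝ) (c : List (Fin g)) :
    Fin n → ℝ := (ncEval X (ncMon c)).mulVec v

/-- The map `H ↦ E(X)[H] v`, for `E` the weighted derivative of a word. -/
noncomputable def derivEval {g n : ℕ} (X : SymTuple g n) (v : Fin n → ℝ) :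
    (ℕ → ℝ) → List (Fin g) → (SymTuple g n →ₗ[ℝ] (Fin n → ℝ))
  | _, [] => 0
  | γ, i :: w => γ 0 • dirEval i (wordVec X v w)
      + (X i : Matrix (Fin n) (Fin n) ℝ).mulVecLin ∘ₗ derivEval X v (fun s => γ (s + 1)) w

theorem ncEvalXH_xMon {g n : ℕ} (X H : SymTuple g n) (w : List (Fin g)) :
    ncEvalXH X H (xMon w) = ncEval X (ncMon w) := by
  induction w with
  | nil => rw [xMon_nil, ncMon_nil, ncEvalXH, ncEval, map_one, map_one]
  | cons i w ih =>
    rw [ncEvalXH, ncEval] at ih ⊢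
    rw [xMon_cons, ncMon_cons, map_mul, map_mul, ih, FreeAlgebra.lift_ι_apply,
      FreeAlgebra.lift_ι_apply, Sum.elim_inl]

theorem ncEvalXH_weightedDeriv {g n : ℕ} (X H : SymTuple g n) (v : Fin n → ℝ) (γ : ℕ → ℝ)
    (w : List (Fin g)) :
    (ncEvalXH X H (weightedDeriv γ w)).mulVec v = derivEval X v γ w H := by
  induction w generalizing γ with
  | nil => rw [weightedDeriv_nil, ncEvalXH, map_zero, Matrix.zero_mulVec]; rfl
  | cons i w ih =>
    have hx := ncEvalXH_xMon X H w
    rw [weightedDeriv_cons, derivEval, LinearMap.add_apply, LinearMap.comp_apply, ← ih,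
      LinearMap.smul_apply, dirEval_apply, wordVec, ← hx]
    simp only [ncEvalXH, map_add, map_smul, map_mul, FreeAlgebra.lift_ι_apply, Sum.elim_inl,
      Sum.elim_inr, Matrix.add_mulVec, Matrix.smul_mulVec, Matrix.mulVec_mulVec,
      Matrix.mulVecLin_apply]

theorem derivEval_eq_zero {g n : ℕ} {X H : SymTuple g n} {v : Fin n → ℝ} (γ : ℕ → ℝ)
    {w : List (Fin g)} (hw : ∀ i c, (i :: c) <:+ w → dirEval i (wordVec X v c) H = 0) :
    derivEval X v γ w H = 0 := by
  induction w generalizing γ with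
  | nil => rfl
  | cons i w ih =>
    rw [derivEval, LinearMap.add_apply, LinearMap.comp_apply,
      ih _ (fun j c h => hw j c (h.trans (List.suffix_cons i w))), map_zero, LinearMap.smul_apply,
      hw i w (List.suffix_refl _), smul_zero, add_zero]

/-- The system is triangular: T_{ic}(X)[H]v is β 0 · H_i c(X)v plus terms built from proper suffixes
of ic, which vanish by induction. -/
theorem dirEval_eq_zero_of_derivEval {g n d : ℕ} {X H : SymTuple g n} {v : Fin n → ℝ} {β : ℕ → ℝ}
    (hβ : β 0 ≠ 0)
    (h : ∀ u : Fin g × ShortWord g d, derivEval X v β (idxWord u) H = 0)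
    (w : List (Fin g)) (hw : w.length + 1 ≤ d) (i : Fin g) (c : List (Fin g))
    (hc : (i :: c) <:+ w) : dirEval i (wordVec X v c) H = 0 := by
  induction w generalizing i c with
  | nil => simp at hc
  | cons j w ih =>
    rw [List.length_cons] at hw
    have ih' := ih (by omega)
    rcases List.suffix_cons_iff.mp hc with hc | hc
    · obtain ⟨rfl, rfl⟩ := List.cons.inj hc
      have := h (i, ⟨c, by omega⟩)
      rw [idxWord, derivEval, LinearMap.add_apply, LinearMap.comp_apply,
        derivEval_eq_zero _ ih', map_zero, add_zero, LinearMap.smul_apply] at this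
      exact (smul_eq_zero.mp this).resolve_left hβ
    · exact ih' i c hc

theorem ncEvalXH_star {g n : ℕ} (X H : SymTuple g n) (f : NCPolyXH g) :
    ncEvalXH X H (star f) = (ncEvalXH X H f).transpose := by
  unfold ncEvalXH
  induction f using FreeAlgebra.induction with
  | grade0 r =>
    rw [FreeAlgebra.star_algebraMap, AlgHom.commutes, Matrix.algebraMap_eq_diagonal,
      Matrix.diagonal_transpose]
  | grade1 x =>
    rw [FreeAlgebra.star_ι, FreeAlgebra.lift_ι_apply]
    cases x with
    | inl i => exact (X i).2.symm
    | inr i => exact (H i).2.symm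
  | mul a b ha hb => rw [star_mul, map_mul, map_mul, ha, hb, Matrix.transpose_mul]
  | add a b ha hb => rw [star_add, map_add, map_add, ha, hb, Matrix.transpose_add]

theorem ncEvalXH_sum_squares {g n : ℕ} {ι : Type} [Fintype ι] (X H : SymTuple g n)
    (v : Fin n → ℝ) (μ : ι → ℝ) (F : ι → NCPolyXH g) :
    (ncEvalXH X H (∑ i, μ i • (star (F i) * F i))).mulVec v ⬝ᵥ v
      = ∑ i, μ i * ((ncEvalXH X H (F i)).mulVec v ⬝ᵥ (ncEvalXH X H (F i)).mulVec v) := by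
  have h : ncEvalXH X H (∑ i, μ i • (star (F i) * F i))
      = ∑ i, μ i • ((ncEvalXH X H (F i)).transpose * ncEvalXH X H (F i)) := by
    simp only [← ncEvalXH_star]
    simp only [ncEvalXH, map_sum, map_smul, map_mul]
  rw [h, Matrix.sum_mulVec, sum_dotProduct]
  refine Finset.sum_congr rfl fun i _ => ?_
  rw [Matrix.smul_mulVec, smul_dotProduct, smul_eq_mul, ← Matrix.mulVec_mulVec,
    Matrix.mulVec_transpose, ← Matrix.dotProduct_mulVec]

/-! ### Independence of the word vectors and rank of the border map. -/

theorem card_shortWord (g d : ℕ) : Fintype.card (ShortWord g d) = wordCount g d := by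
  let e : ShortWord g d ≃ Σ i : Fin (d - 1), List.Vector (Fin g) i :=
    { toFun := fun w => ⟨⟨w.1.length, by have := w.2; omega⟩, ⟨w.1, rfl⟩⟩
      invFun := fun x => ⟨x.2.1, by have := x.2.2; have := x.1.2; omega⟩
      left_inv := fun _ => rfl
      right_inv := by
        rintro ⟨⟨i, hi⟩, ⟨w, hw⟩⟩
        have hi' : i = w.length := hw.symm
        subst hi'
        rfl }
  rw [Fintype.card_congr e, Fintype.card_sigma, wordCount, ← Fin.sum_univ_eq_sum_range]
  simp

theorem linearIndependent_wordVec {g d n : ℕ} {X : SymTuple g n} {v : Fin n → ℝ}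
    (hv : ¬ ∃ q : NCPoly (Fin g), q ≠ 0 ∧ ncDegree q + 2 ≤ d ∧ (ncEval X q).mulVec v = 0) :
    LinearIndependent ℝ (fun c : ShortWord g d => wordVec X v c.1) := by
  classical
  rw [Fintype.linearIndependent_iff]
  intro a ha c
  by_contra hc
  have hcoeff : ∀ w, ncCoeff (∑ e : ShortWord g d, a e • ncMon e.1) w
      = ∑ e : ShortWord g d, if FreeMonoid.ofList e.1 = w then a e else 0 := fun w => by
    rw [ncCoeff_sum, Finsupp.finsetSum_apply]
    refine Finset.sum_congr rfl fun e _ => ?_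
    rw [ncCoeff_smul, ncCoeff_ncMon, Finsupp.smul_apply, Finsupp.single_apply]
    split_ifs <;> simp
  refine hv ⟨∑ e : ShortWord g d, a e • ncMon e.1, ?_, ?_, ?_⟩
  · intro h0
    have := hcoeff (FreeMonoid.ofList c.1)
    rw [h0, ncCoeff_zero, Finset.sum_eq_single c (fun e _ he => if_neg fun h => he
      (Subtype.ext (FreeMonoid.ofList.injective h))) (by simp), if_pos rfl] at this
    exact hc this.symm
  · have hcd := c.2
    suffices ncDegree (∑ e : ShortWord g d, a e • ncMon e.1) ≤ d - 2 by omega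
    refine Finset.sup_le fun w hw => ?_
    rw [Finsupp.mem_support_iff, hcoeff] at hw
    obtain ⟨e, -, he⟩ := Finset.exists_ne_zero_of_sum_ne_zero hw
    have hew : FreeMonoid.ofList e.1 = w := by
      by_contra h
      exact he (if_neg h)
    rw [← hew]
    have := e.2
    change e.1.length ≤ d - 2
    omega
  · rw [← ha, ncEval, map_sum, Matrix.sum_mulVec]
    refine Finset.sum_congr rfl fun e _ => ?_
    rw [map_smul, Matrix.smul_mulVec]
    rfl

-- The pairwise conditions, clearly necessary, say that YᵀW is symmetric. They suffice because W has
-- a left inverse L.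
open Matrix in
theorem exists_isSymm_mulVec_eq {n : ℕ} {C : Type} [Fintype C] [DecidableEq C]
    {w y : C → Fin n → ℝ}
    (hw : LinearIndependent ℝ w) (hy : ∀ a b, y a ⬝ᵥ w b = y b ⬝ᵥ w a) :
    ∃ A : Matrix (Fin n) (Fin n) ℝ, A.IsSymm ∧ ∀ c, A.mulVec (w c) = y c := by
  let W : Matrix (Fin n) C ℝ := Matrix.of fun i c => w c i
  let Y : Matrix (Fin n) C ℝ := Matrix.of fun i c => y c i
  have hinj : Function.Injective W.mulVec := Matrix.mulVec_injective_iff.mpr hw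
  obtain ⟨L', hL'⟩ := LinearMap.exists_leftInverse_of_injective (Matrix.toLin' W)
    (LinearMap.ker_eq_bot.mpr hinj)
  obtain ⟨L, hL⟩ : ∃ L : Matrix C (Fin n) ℝ, L * W = 1 := by
    refine ⟨LinearMap.toMatrix' L', ?_⟩
    apply Matrix.toLin'.injective
    rw [Matrix.toLin'_mul, Matrix.toLin'_toMatrix', hL', Matrix.toLin'_one]
  have hYW : Yᵀ * W = Wᵀ * Y := by
    ext a b
    simp only [Matrix.mul_apply, Matrix.transpose_apply, W, Y, Matrix.of_apply]
    have := hy a b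
    simp only [dotProduct] at this
    rw [this]
    exact Finset.sum_congr rfl fun i _ => mul_comm _ _
  -- `Y * L` already sends W to Y. Adding its transpose makes it symmetric, and the last term
  -- cancels the excess LᵀYᵀW.
  refine ⟨Y * L + Lᵀ * Yᵀ - Lᵀ * (Wᵀ * Y) * L, ?_, fun c => ?_⟩
  · rw [Matrix.IsSymm, transpose_sub, transpose_add]
    simp only [transpose_mul, transpose_transpose]
    rw [hYW]
    simp only [Matrix.mul_assoc]
    rw [add_comm]
  · have h : (Y * L + Lᵀ * Yᵀ - Lᵀ * (Wᵀ * Y) * L) * W = Y := by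
      rw [Matrix.sub_mul, Matrix.add_mul, Matrix.mul_assoc Y, hL, Matrix.mul_assoc _ L, hL,
        Matrix.mul_assoc Lᵀ Yᵀ, hYW, Matrix.mul_one, Matrix.mul_one, add_sub_cancel_right]
    ext i
    exact congrFun (congrFun h i) c

/-- The map `H ↦ (H_j w_c)_{j,c}`. -/
noncomputable def borderMap {n : ℕ} (g : ℕ) {C : Type} (w : C → Fin n → ℝ) :
    SymTuple g n →ₗ[ℝ] (Fin g → C → Fin n → ℝ) :=
  LinearMap.pi fun j => LinearMap.pi fun c => dirEval j (w c)

/-- The range contains the solution space of the symmetry conditions, one for each letter and each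
unordered pair of distinct vectors. -/
theorem le_finrank_range_borderMap {n g : ℕ} {C : Type} [Fintype C] {w : C → Fin n → ℝ}
    (hw : LinearIndependent ℝ w) :
    g * (Fintype.card C * n) ≤ Module.finrank ℝ (LinearMap.range (borderMap g w))
      + g * (Fintype.card C * (Fintype.card C - 1) / 2) := by
  classical
  let e := (Fintype.equivFin C).symm
  let dot : (Fin n → ℝ) → ((Fin n → ℝ) →ₗ[ℝ] ℝ) := fun z => (dotProductBilin ℝ ℝ).flip z
  -- The sigma type lists the pairs b < a, so each condition is counted once.
  let K : (Fin g → C → Fin n → ℝ) →ₗ[ℝ] (Fin g × (Σ a : Fin (Fintype.card C), Fin a) → ℝ) :=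
    LinearMap.pi fun t =>
      (dot (w (e (t.2.2.castLE t.2.1.2.le))) ∘ₗ LinearMap.proj (e t.2.1)
        - dot (w (e t.2.1)) ∘ₗ LinearMap.proj (e (t.2.2.castLE t.2.1.2.le))) ∘ₗ LinearMap.proj t.1
  have hK : LinearMap.ker K ≤ LinearMap.range (borderMap g w) := by
    intro y hy
    have hlt : ∀ j (a b : Fin (Fintype.card C)), b < a →
        y j (e a) ⬝ᵥ w (e b) = y j (e b) ⬝ᵥ w (e a) := fun j a b hab =>
      sub_eq_zero.mp (congrFun (LinearMap.mem_ker.mp hy) (j, ⟨a, ⟨b, hab⟩⟩))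
    have hsymm : ∀ j a b, y j a ⬝ᵥ w b = y j b ⬝ᵥ w a := by
      intro j a b
      obtain ⟨a, rfl⟩ := e.surjective a
      obtain ⟨b, rfl⟩ := e.surjective b
      rcases lt_trichotomy a b with h | rfl | h
      exacts [(hlt j b a h).symm, rfl, hlt j a b h]
    choose A hA hAw using fun j => exists_isSymm_mulVec_eq hw (hsymm j)
    refine ⟨fun j => ⟨A j, hA j⟩, ?_⟩
    ext j c i
    exact congrFun (hAw j c) i
  have h1 := Submodule.finrank_mono hK
  have h2 := LinearMap.finrank_range_add_finrank_ker K
  have h3 : Module.finrank ℝ (LinearMap.range K)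
      ≤ g * (Fintype.card C * (Fintype.card C - 1) / 2) := by
    refine (Submodule.finrank_le _).trans (le_of_eq ?_)
    rw [Module.finrank_fintype_fun_eq_card, Fintype.card_prod, Fintype.card_fin, Fintype.card_sigma]
    simp only [Fintype.card_fin]
    rw [Fin.sum_univ_eq_sum_range (fun i => i), Finset.sum_range_id]
  have h4 : Module.finrank ℝ (Fin g → C → Fin n → ℝ) = g * (Fintype.card C * n) := by
    simp [Module.finrank_pi_fintype]
  omega

theorem finrank_le_of_ker_le {V M N : Type*} [AddCommGroup V] [Module ℝ V] [FiniteDimensional ℝ V]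
    [AddCommGroup M] [Module ℝ M] [AddCommGroup N] [Module ℝ N] [FiniteDimensional ℝ N]
    (𝓗 : Submodule ℝ V) (Φ : V →ₗ[ℝ] N) (S : V →ₗ[ℝ] M) (h : ∀ H ∈ 𝓗, Φ H = 0 → S H = 0) :
    Module.finrank ℝ 𝓗 ≤ Module.finrank ℝ N + Module.finrank ℝ (LinearMap.ker S) := by
  have h1 := LinearMap.finrank_range_add_finrank_ker (Φ.domRestrict 𝓗)
  have h2 : Module.finrank ℝ (LinearMap.ker (Φ.domRestrict 𝓗))
      ≤ Module.finrank ℝ (LinearMap.ker S) := by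
    rw [(Submodule.equivMapOfInjective _ 𝓗.injective_subtype
      (LinearMap.ker (Φ.domRestrict 𝓗))).finrank_eq]
    refine Submodule.finrank_mono ?_
    rintro _ ⟨H, hH, rfl⟩
    exact h H.1 H.2 hH
  have h3 := Submodule.finrank_le (LinearMap.range (Φ.domRestrict 𝓗))
  omega

/-! ### The dimension count. -/

theorem theorem1p7 (g d n k : ℕ) (hk : 0 < k)
    (p : NCPoly (Fin g)) (hp : star p = p) (hd : ncDegree p = d)
    (hn : (g : ℝ) * ((wordCount g d : ℝ) * ((wordCount g d : ℝ) - 1) / 2) < (n : ℝ))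
    (X : SymTuple g n) (v : Fin n → ℝ)
    (hv : ¬ ∃ q : NCPoly (Fin g), q ≠ 0 ∧ ncDegree q + 2 ≤ d ∧ (ncEval X q).mulVec v = 0)
    (𝓗 : Submodule ℝ (SymTuple g n))
    (hcodim : Module.finrank ℝ (SymTuple g n ⧸ 𝓗) ≤ k * n)
    (hpos : HessianPosRel p 𝓗 X v) :
    sigmaMinNeg (ncHessian p) < (k : ℕ∞) + 1 := by
  classical
  obtain ⟨β, U, μ, hβ, hU, hess⟩ := ncHessian_eq_sum_squares hp hd.le
  set F : Fin g × ShortWord g d → NCPolyXH g := fun i => ∑ u, U u i • weightedDeriv β (idxWord u)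
    with hFdef
  have hF : ∀ i, IsLinearInH (F i) := fun i =>
    IsLinearInH.sum _ fun u _ => (isLinearInH_weightedDeriv _ _).smul _
  have hsds := hasSDS_of_eq_sum μ hF hess
  rw [Nat.card_eq_fintype_card] at hsds
  refine (iInf₂_le _ hsds).trans_lt ?_
  suffices Fintype.card {i // μ i < 0} < k + 1 by exact_mod_cast this
  let R : Fin g × ShortWord g d → (SymTuple g n →ₗ[ℝ] (Fin n → ℝ)) := fun i =>
    ∑ u, U u i • derivEval X v β (idxWord u)
  have hR : ∀ i H, (ncEvalXH X H (F i)).mulVec v = R i H := fun i H => by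
    simp only [hFdef, R, LinearMap.sum_apply, LinearMap.smul_apply, ← ncEvalXH_weightedDeriv]
    rw [ncEvalXH, map_sum, Matrix.sum_mulVec]
    simp only [map_smul, Matrix.smul_mulVec]
    rfl
  let Φ : SymTuple g n →ₗ[ℝ] ({i // ¬ μ i < 0} → Fin n → ℝ) := LinearMap.pi fun i => R i.1
  let w : ShortWord g d → Fin n → ℝ := fun c => wordVec X v c.1
  have hker : ∀ H ∈ 𝓗, Φ H = 0 → borderMap g w H = 0 := by
    intro H hH hΦ
    have hR0 : ∀ i, R i H = 0 := by
      have hq := hpos H hH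
      rw [hess, ncEvalXH_sum_squares X H v μ F] at hq
      simp only [hR] at hq
      have hnonneg : ∀ i, ¬ μ i < 0 → R i H = 0 := fun i hi => congrFun hΦ ⟨i, hi⟩
      have hle : ∀ i, μ i * (R i H ⬝ᵥ R i H) ≤ 0 := fun i => by
        by_cases hi : μ i < 0
        · exact mul_nonpos_of_nonpos_of_nonneg hi.le (Finset.sum_nonneg fun j _ => mul_self_nonneg _)
        · rw [hnonneg i hi]; simp
      -- A sum of nonpositive terms that is itself nonnegative has only zero terms.
      have hzero := (Finset.sum_eq_zero_iff_of_nonpos fun i _ => hle i).mp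
        (le_antisymm (Finset.sum_nonpos fun i _ => hle i) hq)
      intro i
      by_cases hi : μ i < 0
      · exact dotProduct_self_eq_zero.mp
          ((mul_eq_zero.mp (hzero i (Finset.mem_univ i))).resolve_left hi.ne)
      · exact hnonneg i hi
    have hT : ∀ u : Fin g × ShortWord g d, derivEval X v β (idxWord u) H = 0 := by
      intro y
      -- Orthogonality of U recovers the word derivatives from the F_i.
      have hy : ∑ i, U y i • R i H = derivEval X v β (idxWord y) H := by
        simp only [R, LinearMap.sum_apply, LinearMap.smul_apply, Finset.smul_sum, smul_smul]
        rw [Finset.sum_comm]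
        have hUU : ∀ u, ∑ i, U y i * U u i = if y = u then 1 else 0 := fun u => by
          have := congrFun (congrFun hU y) u
          rwa [Matrix.mul_apply, Matrix.one_apply] at this
        simp only [← Finset.sum_smul, hUU, ite_smul, one_smul, zero_smul, Finset.sum_ite_eq,
          Finset.mem_univ, if_true]
      rw [← hy]
      simp [hR0]
    ext j c i
    exact congrFun (dirEval_eq_zero_of_derivEval hβ hT (j :: c.1)
      (by have := c.2; rw [List.length_cons]; omega) j c.1 (List.suffix_refl _)) i
  have h1 := finrank_le_of_ker_le 𝓗 Φ (borderMap g w) hker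
  have h2 := le_finrank_range_borderMap (g := g) (linearIndependent_wordVec hv)
  have h3 := LinearMap.finrank_range_add_finrank_ker (borderMap g w)
  have h4 := Submodule.finrank_quotient_add_finrank 𝓗
  have h5 : Module.finrank ℝ ({i // ¬ μ i < 0} → Fin n → ℝ)
      = Fintype.card {i // ¬ μ i < 0} * n := by
    simp [Module.finrank_pi_fintype]
  have h6 : Fintype.card {i // μ i < 0} + Fintype.card {i // ¬ μ i < 0} = g * wordCount g d := by
    rw [← card_shortWord, Fintype.card_subtype_compl, ← Nat.add_sub_assoc
      (Fintype.card_subtype_le _), Nat.add_sub_cancel_left, Fintype.card_prod, Fintype.card_fin]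
  rw [card_shortWord] at h2
  -- Truncated subtraction is harmless at ν = 0, and the division by 2 is exact; both follow from
  -- the binomial coefficient.
  have h7 : g * (wordCount g d * (wordCount g d - 1) / 2) < n := by
    have h8 : ((wordCount g d * (wordCount g d - 1) / 2 : ℕ) : ℝ)
        = (wordCount g d : ℝ) * ((wordCount g d : ℝ) - 1) / 2 := by
      rw [← Nat.choose_two_right, Nat.cast_choose_two]
    rw [← h8] at hn
    exact_mod_cast hn
  have h8 : g * (wordCount g d * n)
      = Fintype.card {i // μ i < 0} * n + Fintype.card {i // ¬ μ i < 0} * n := by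
    rw [← add_mul, h6, mul_assoc]
  have h9 : Fintype.card {i // μ i < 0} * n < (k + 1) * n := by
    rw [add_mul, one_mul]
    change g * (wordCount g d * n) ≤ Module.finrank ℝ (LinearMap.range (borderMap g w)) + _ at h2
    omega
  exact lt_of_mul_lt_mul_right h9 (Nat.zero_le n)
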